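/- Let $s\ge 0$ and $d\ge 1$ be integers and let $\mathbb T=\{z\in\mathbb C:|z|=1\}$. Let $\mu$ be a Hermitian positive semidefinite $\mathbb C^{s\times s}$-valued Borel measure on $\mathbb T$, that is, a countably additive set function $\mu$ on the Borel subsets of $\mathbb T$ such that $\mu(\Omega)\in\mathbb C^{s\times s}$ is Hermitian positive semidefinite for each Borel set $\Omega\subseteq\mathbb T$. For matrix polynomials $P(z)=\sum_k z^kC_k$ and $Q(z)=\sum_k z^kD_k$ with coefficients in $\mathbb C^{s\times s}$ put $$\langle\!\langle P,Q\rangle\!\rangle_\mu=\int_{\mathbb T}P(z)^*\,\mathrm d\mu(z)\,Q(z)\in\mathbb C^{s\times s}.$$ Suppose that $\langle\!\langle\cdot,\cdot\rangle\!\rangle_\mu$ is nondegenerate on the matrix polynomials of degree at most $d$, i.e. $\langle\!\langle P,P\rangle\!\rangle_\mu\neq 0$ for every matrix polynomial $P\not\equiv 0$ of degree at most $d$. Then there is a Hermitian positive semidefinite $\mathbb C^{s\times s}$-valued Borel measure $\widetilde\mu$ on $\mathbb T$ such that $\langle\!\langle\cdot,\cdot\rangle\!\rangle_{\widetilde\mu}$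 is nondegenerate on all matrix polynomials, i.e. $\langle\!\langle P,P\rangle\!\rangle_{\widetilde\mu}$ is positive definite for every monic matrix polynomial $P$ (one whose leading coefficient is the identity matrix), and $\langle\!\langle P,P\rangle\!\rangle_{\widetilde\mu}\neq 0$ for every matrix polynomial $P\not\equiv 0$; and moreover $$\langle\!\langle P,Q\rangle\!\rangle_{\mu}=\langle\!\langle P,Q\rangle\!\rangle_{\widetilde\mu}$$ for all matrix polynomials $P,Q$ of degree at most $d$. -/

import Mathlib

open MeasureTheory
open scoped Polynomial ComplexOrder

noncomputable section

namespace OMPUC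

/-- The unit circle `𝕋 = {z : ℂ | |z| = 1}`, with the Borel σ-algebra inherited from `ℂ`. -/
abbrev UnitCircle : Type := Metric.sphere (0 : ℂ) 1

/-- (Countably additive) `s × s` complex matrix-valued measures on the unit circle. -/
abbrev MatrixMeasure (s : ℕ) : Type :=
  VectorMeasure UnitCircle (Matrix (Fin s) (Fin s) ℂ)

/-- Matrix polynomials `P(z) = ∑ z ^ k C_k` with `s × s` complex matrix coefficients. -/
abbrev MatrixPoly (s : ℕ) : Type := (Matrix (Fin s) (Fin s) ℂ)[X]

namespace MatrixPoly

/-- The value `P(z) = ∑ z ^ k C_k` of a matrix polynomial at a complex number. -/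
def evalAt {s : ℕ} (P : MatrixPoly s) (z : ℂ) : Matrix (Fin s) (Fin s) ℂ :=
  P.sum fun k C => z ^ k • C

end MatrixPoly

namespace MatrixMeasure

variable {s : ℕ}

/-- The measure is Hermitian positive semidefinite: so is its value on each Borel set. -/
def IsPosSemidef (μ : MatrixMeasure s) : Prop :=
  ∀ Ω : Set UnitCircle, MeasurableSet Ω → (μ Ω).PosSemidef

/-- The `(i, j)` entry of a matrix-valued measure, a complex measure. -/
def entry (μ : MatrixMeasure s) (i j : Fin s) : ComplexMeasure UnitCircle :=
  μ.mapRange (Matrix.entryAddMonoidHom ℂ i j) (continuous_id.matrix_elem i j)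

theorem entry_apply (μ : MatrixMeasure s) (i j : Fin s) (Ω : Set UnitCircle) :
    μ.entry i j Ω = μ Ω i j := rfl

/-- The integral `∫ f dν` of a complex function against a complex measure. -/
def cintegral (ν : ComplexMeasure UnitCircle) (f : UnitCircle → ℂ) : ℂ :=
  VectorMeasure.integral ν f (ContinuousLinearMap.mul ℝ ℂ)

/-- The right matrix-valued inner product `⟪P, Q⟫_μ = ∫ P(z)ᴴ dμ(z) Q(z)`, whose `(i, j)` entry is
`∑ k l, ∫ conj (P(z) k i) * Q(z) l j dμ_{k l}(z)`. -/
def innerProd (μ : MatrixMeasure s) (P Q : MatrixPoly s) : Matrix (Fin s) (Fin s) ℂ :=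
  Matrix.of fun i j => ∑ k, ∑ l,
    cintegral (μ.entry k l) fun z => star (P.evalAt (z : ℂ) k i) * Q.evalAt (z : ℂ) l j

/-- `⟪P, P⟫_μ` is positive definite for every monic matrix polynomial `P`. -/
def IsNondegenerate (μ : MatrixMeasure s) : Prop :=
  ∀ P : MatrixPoly s, P.Monic → (μ.innerProd P P).PosDef

/-- `⟪P, P⟫_μ ≠ 0` for every nonzero matrix polynomial `P` of degree at most `d`. -/
def IsNondegenerateUpTo (μ : MatrixMeasure s) (d : ℕ) : Prop :=
  ∀ P : MatrixPoly s, P.natDegree ≤ d → P ≠ 0 → μ.innerProd P P ≠ 0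

end MatrixMeasure

end OMPUC

end

/-! Both inner products are read off from block Toeplitz moment matrices: ⟪P, Q⟫ is A*TB, with A and
B the coefficient columns of P and Q (`innerProd_eq`). Nondegeneracy up to degree d makes the matrix
T of μ positive definite (`toeplitz_posDef`), so T - εS is still positive semidefinite for small ε >
0, where S is the matrix of Haar measure (`exists_pos_posSemidef_sub_smul`). This difference is
again block Toeplitz, so it is the moment matrix of a finite sum of atoms ν
(`exists_atoms_of_toeplitz`): its Gram vectors are shifted by an isometry, whose spectral
decomposition supplies the atoms. Adding ε times Haar measure to ν restores the moments of μ up to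
d, and makes the moment matrices of every size positive definite (`toeplitz_haar_posDef`). -/

namespace OMPUC

namespace MatrixMeasure

open Filter Topology Matrix

variable {s : ℕ}

/-! ### Integration against complex measures; positivity of the quadratic form. -/

instance isFiniteMeasure_variation (ν : ComplexMeasure UnitCircle) :
    IsFiniteMeasure ν.variation := by
  refine isFiniteMeasure_of_le (ν.re.totalVariation + ν.im.totalVariation) ?_
  refine VectorMeasure.variation_le_of_forall_enorm_le fun E _ => ?_
  have h : ‖ν E‖ₑ ≤ ‖ν.re E‖ₑ + ‖ν.im E‖ₑ := by
    change ‖ν E‖ₑ ≤ ‖(ν E).re‖ₑ + ‖(ν E).im‖ₑ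
    simp only [← ofReal_norm]
    rw [← ENNReal.ofReal_add (norm_nonneg _) (norm_nonneg _)]
    exact ENNReal.ofReal_le_ofReal (Complex.norm_le_abs_re_add_abs_im _)
  exact h.trans (add_le_add (SignedMeasure.enorm_le_totalVariation _ _)
    (SignedMeasure.enorm_le_totalVariation _ _))

theorem integrable_of_continuous {m : Measure UnitCircle} [IsFiniteMeasure m]
    {E : Type*} [NormedAddCommGroup E] {f : UnitCircle → E} (hf : Continuous f) :
    Integrable f m :=
  integrableOn_univ.1 (hf.continuousOn.integrableOn_compact isCompact_univ)

theorem cintegral_const_mul (ν : ComplexMeasure UnitCircle) (c : ℂ) (f : UnitCircle → ℂ) :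
    cintegral ν (fun z => c * f z) = c * cintegral ν f := by
  unfold cintegral
  rw [VectorMeasure.integral_eq_setToFun, VectorMeasure.integral_eq_setToFun]
  refine setToFun_smul (𝕜 := ℂ) _ (fun c S x => ?_) c f
  change (c * x) * ν S = c * (x * ν S)
  ring

theorem cintegral_finset_sum {ι : Type*} (ν : ComplexMeasure UnitCircle) (S : Finset ι)
    {f : ι → UnitCircle → ℂ} (hf : ∀ a ∈ S, ν.Integrable (f a)) :
    cintegral ν (fun z => ∑ a ∈ S, f a z) = ∑ a ∈ S, cintegral ν (f a) :=
  VectorMeasure.integral_finsetSum S hf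

theorem cintegral_indicator_const (ν : ComplexMeasure UnitCircle) {S : Set UnitCircle}
    (hS : MeasurableSet S) (c : ℂ) :
    cintegral ν (S.indicator fun _ => c) = c * ν S := by
  unfold cintegral
  have := VectorMeasure.integral_indicator (μ := ν) (B := ContinuousLinearMap.mul ℝ ℂ)
    (f := fun _ => c) hS
  rw [show (S.indicator fun _ => c) = fun x => S.indicator (fun _ => c) x from rfl, this,
    VectorMeasure.setIntegral_const]
  rfl

/-- On the fiber over y the integrand is constant, so the form is the sum of y* μ(fiber) y. -/
theorem quadratic_simpleFunc_nonneg {μ : MatrixMeasure s} (hμ : μ.IsPosSemidef)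
    (φ : SimpleFunc UnitCircle (Fin s → ℂ)) :
    0 ≤ ∑ k, ∑ l, cintegral (μ.entry k l) (fun z => star (φ z k) * φ z l) := by
  have key : ∀ k l, cintegral (μ.entry k l) (fun z => star (φ z k) * φ z l) =
      ∑ y ∈ φ.range, (star (y k) * y l) * μ (φ ⁻¹' {y}) k l := by
    intro k l
    have : (fun z => star (φ z k) * φ z l) = fun z => ∑ y ∈ φ.range,
        (φ ⁻¹' {y}).indicator (fun _ => star (y k) * y l) z := by
      funext z
      rw [Finset.sum_eq_single (φ z)]
      · simp
      · intro y _ hy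
        exact Set.indicator_of_notMem (by simpa using Ne.symm hy) _
      · intro h
        exact absurd (φ.mem_range_self z) h
    rw [this, cintegral_finset_sum]
    · refine Finset.sum_congr rfl fun y _ => ?_
      rw [cintegral_indicator_const _ (φ.measurableSet_fiber y), entry_apply]
    · intro y _
      exact (integrable_const _).indicator (φ.measurableSet_fiber y)
  simp_rw [key]
  have : ∑ k, ∑ l, ∑ y ∈ φ.range, (star (y k) * y l) * μ (φ ⁻¹' {y}) k l =
      ∑ y ∈ φ.range, star y ⬝ᵥ (μ (φ ⁻¹' {y}) *ᵥ y) := by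
    rw [Finset.sum_congr rfl fun k _ => Finset.sum_comm, Finset.sum_comm]
    refine Finset.sum_congr rfl fun y _ => ?_
    simp only [dotProduct, mulVec, Finset.mul_sum, Pi.star_apply]
    refine Finset.sum_congr rfl fun k _ => Finset.sum_congr rfl fun l _ => ?_
    ring
  rw [this]
  exact Finset.sum_nonneg fun y _ =>
    (hμ _ (φ.measurableSet_fiber y)).dotProduct_mulVec_nonneg y

/-- The quadratic form of a positive semidefinite matrix measure is nonnegative on continuous
vector functions. -/
theorem quadratic_nonneg {μ : MatrixMeasure s} (hμ : μ.IsPosSemidef)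
    {g : UnitCircle → Fin s → ℂ} (hg : Continuous g) :
    0 ≤ ∑ k, ∑ l, cintegral (μ.entry k l) (fun z => star (g z k) * g z l) := by
  let φ : ℕ → SimpleFunc UnitCircle (Fin s → ℂ) :=
    SimpleFunc.approxOn g hg.measurable Set.univ 0 (Set.mem_univ _)
  obtain ⟨C, hC⟩ : ∃ C, ∀ z, ‖g z‖ ≤ C := by
    obtain ⟨C, hC⟩ := isCompact_univ.exists_bound_of_continuousOn hg.continuousOn
    exact ⟨C, fun z => hC z (Set.mem_univ _)⟩
  -- The approximants start from 0, which gives ‖φ n z‖ ≤ 2‖g z‖, a uniform bound for dominated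
  -- convergence.
  have hφ : ∀ n z, ‖φ n z‖ ≤ C + C := fun n z =>
    (SimpleFunc.norm_approxOn_zero_le hg.measurable (Set.mem_univ _) z n).trans
      (add_le_add (hC z) (hC z))
  have hlim : ∀ z, Tendsto (fun n => φ n z) atTop (𝓝 (g z)) := fun z =>
    SimpleFunc.tendsto_approxOn hg.measurable (Set.mem_univ _) (by simp)
  have hT : Tendsto (fun n => ∑ k, ∑ l, cintegral (μ.entry k l)
      (fun z => star (φ n z k) * φ n z l)) atTop
      (𝓝 (∑ k, ∑ l, cintegral (μ.entry k l) (fun z => star (g z k) * g z l))) := by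
    refine tendsto_finsetSum _ fun k _ => tendsto_finsetSum _ fun l _ => ?_
    refine VectorMeasure.tendsto_integral_filter_of_norm_le_const
      (Eventually.of_forall fun n => ?_) ⟨(C + C) * (C + C), Eventually.of_forall fun n =>
        Eventually.of_forall fun z => ?_⟩ (Eventually.of_forall fun z => ?_)
    · have h1 : ∀ j, Measurable fun z => φ n z j := fun j =>
        (measurable_pi_apply j).comp (φ n).measurable
      exact ((continuous_star.measurable.comp (h1 k)).mul (h1 l)).aestronglyMeasurable
    · rw [norm_mul, norm_star]
      have := hφ n z
      exact mul_le_mul ((norm_le_pi_norm _ k).trans this) ((norm_le_pi_norm _ l).trans this)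
        (norm_nonneg _) ((norm_nonneg _).trans this)
    · have h1 := fun j => (tendsto_pi_nhds.1 (hlim z)) j
      exact (h1 k).star.mul (h1 l)
  exact ge_of_tendsto' hT fun n => quadratic_simpleFunc_nonneg hμ (φ n)

/-! ### Block Toeplitz moment matrices. -/

/-- The block Toeplitz matrix of the moments of a matrix measure. -/
noncomputable def toeplitz (μ : MatrixMeasure s) (N : ℕ) :
    Matrix (Fin (N + 1) × Fin s) (Fin (N + 1) × Fin s) ℂ :=
  Matrix.of fun a b => cintegral (μ.entry a.2 b.2) fun z =>
    star ((z : ℂ) ^ (a.1 : ℕ)) * (z : ℂ) ^ (b.1 : ℕ)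

/-- The column of coefficients of a matrix polynomial. -/
def coeffMatrix (N : ℕ) (P : MatrixPoly s) : Matrix (Fin (N + 1) × Fin s) (Fin s) ℂ :=
  Matrix.of fun a i => P.coeff a.1 a.2 i

theorem evalAt_apply {N : ℕ} {P : MatrixPoly s} (hP : P.natDegree ≤ N) (z : ℂ) (k i : Fin s) :
    P.evalAt z k i = ∑ m : Fin (N + 1), P.coeff m k i * z ^ (m : ℕ) := by
  rw [MatrixPoly.evalAt, Polynomial.sum_over_range' _ (by simp) (N + 1) (by omega),
    ← Fin.sum_univ_eq_sum_range (fun m => z ^ m • P.coeff m), Matrix.sum_apply]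
  exact Finset.sum_congr rfl fun m _ => by simp [mul_comm]

theorem continuous_monomial (a b : ℕ) :
    Continuous fun z : UnitCircle => star ((z : ℂ) ^ a) * (z : ℂ) ^ b := by
  fun_prop

theorem cintegral_star_sum_mul_sum (ν : ComplexMeasure UnitCircle) {N : ℕ}
    (u v : Fin (N + 1) → ℂ) :
    cintegral ν (fun z => star (∑ m, u m * (z : ℂ) ^ (m : ℕ)) * ∑ n, v n * (z : ℂ) ^ (n : ℕ)) =
      ∑ m, ∑ n, star (u m) * v n *
        cintegral ν fun z => star ((z : ℂ) ^ (m : ℕ)) * (z : ℂ) ^ (n : ℕ) := by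
  have : (fun z : UnitCircle => star (∑ m, u m * (z : ℂ) ^ (m : ℕ)) *
      ∑ n, v n * (z : ℂ) ^ (n : ℕ)) = fun z : UnitCircle => ∑ m, ∑ n, star (u m) * v n *
        (star ((z : ℂ) ^ (m : ℕ)) * (z : ℂ) ^ (n : ℕ)) := by
    funext z
    rw [star_sum, Finset.sum_mul_sum]
    refine Finset.sum_congr rfl fun m _ => Finset.sum_congr rfl fun n _ => ?_
    rw [star_mul']
    ring
  rw [this, cintegral_finset_sum]
  · refine Finset.sum_congr rfl fun m _ => ?_
    rw [cintegral_finset_sum]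
    · exact Finset.sum_congr rfl fun n _ => cintegral_const_mul _ _ _
    · exact fun n _ => integrable_of_continuous (continuous_const.mul (continuous_monomial _ _))
  · exact fun m _ => integrable_of_continuous (continuous_finsetSum _ fun n _ =>
      continuous_const.mul (continuous_monomial _ _))

theorem sum_comm_blocks {ι κ : Type*} [Fintype ι] [Fintype κ] (f : κ → κ → ι → ι → ℂ) :
    ∑ k, ∑ l, ∑ m, ∑ n, f k l m n = ∑ m, ∑ k, ∑ n, ∑ l, f k l m n := by
  rw [Finset.sum_congr rfl fun k _ => Finset.sum_comm, Finset.sum_comm]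
  exact Finset.sum_congr rfl fun m _ => Finset.sum_congr rfl fun k _ => Finset.sum_comm

theorem innerProd_eq (μ : MatrixMeasure s) {N : ℕ} {P Q : MatrixPoly s}
    (hP : P.natDegree ≤ N) (hQ : Q.natDegree ≤ N) :
    μ.innerProd P Q = (coeffMatrix N P)ᴴ * μ.toeplitz N * coeffMatrix N Q := by
  ext i j
  simp only [innerProd, Matrix.of_apply, evalAt_apply hP, evalAt_apply hQ,
    cintegral_star_sum_mul_sum]
  rw [Matrix.mul_assoc, sum_comm_blocks]
  simp only [Matrix.mul_apply, Finset.mul_sum, Fintype.sum_prod_type, conjTranspose_apply,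
    coeffMatrix, toeplitz, Matrix.of_apply]
  refine Finset.sum_congr rfl fun m _ => Finset.sum_congr rfl fun k _ =>
    Finset.sum_congr rfl fun n _ => Finset.sum_congr rfl fun l _ => ?_
  ring

theorem quadratic_toeplitz (μ : MatrixMeasure s) (N : ℕ) (v : Fin (N + 1) × Fin s → ℂ) :
    star v ⬝ᵥ (μ.toeplitz N *ᵥ v) = ∑ k, ∑ l, cintegral (μ.entry k l) (fun z =>
      star (∑ m, v (m, k) * (z : ℂ) ^ (m : ℕ)) * ∑ n, v (n, l) * (z : ℂ) ^ (n : ℕ)) := by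
  simp only [cintegral_star_sum_mul_sum]
  rw [sum_comm_blocks]
  simp only [dotProduct, mulVec, Finset.mul_sum, Fintype.sum_prod_type, Pi.star_apply,
    toeplitz, Matrix.of_apply]
  refine Finset.sum_congr rfl fun m _ => Finset.sum_congr rfl fun k _ =>
    Finset.sum_congr rfl fun n _ => Finset.sum_congr rfl fun l _ => ?_
  ring

/-- In the order on ℂ, `0 ≤` includes being real, and a complex matrix with real quadratic form is
Hermitian. -/
theorem isHermitian_of_quadratic_nonneg {n : Type*} [Fintype n] {A : Matrix n n ℂ}
    (h : ∀ v, 0 ≤ star v ⬝ᵥ (A *ᵥ v)) : A.IsHermitian := by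
  classical
  rw [← Matrix.isSymmetric_toEuclideanLin_iff, LinearMap.isSymmetric_iff_inner_map_self_real]
  intro v
  rw [← inner_conj_symm, Complex.conj_conj]
  have h1 : inner ℂ v (Matrix.toEuclideanLin A v) = star v.ofLp ⬝ᵥ (A *ᵥ v.ofLp) := by
    rw [EuclideanSpace.inner_eq_star_dotProduct, dotProduct_comm]
    rfl
  rw [h1]
  exact (Complex.conj_eq_iff_im.2 (Complex.nonneg_iff.1 (h v.ofLp)).2.symm).symm

theorem toeplitz_posSemidef {μ : MatrixMeasure s} (hμ : μ.IsPosSemidef) (N : ℕ) :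
    (μ.toeplitz N).PosSemidef := by
  have h : ∀ v, 0 ≤ star v ⬝ᵥ (μ.toeplitz N *ᵥ v) := fun v => by
    rw [quadratic_toeplitz]
    exact quadratic_nonneg hμ (g := fun z k => ∑ m, v (m, k) * (z : ℂ) ^ (m : ℕ)) (by fun_prop)
  exact .of_dotProduct_mulVec_nonneg (isHermitian_of_quadratic_nonneg h) h

theorem toeplitz_posDef {μ : MatrixMeasure s} (hμ : μ.IsPosSemidef) {d : ℕ}
    (hnd : μ.IsNondegenerateUpTo d) : (μ.toeplitz d).PosDef := by
  refine .of_dotProduct_mulVec_pos (toeplitz_posSemidef hμ d).1 fun v hv => ?_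
  refine lt_of_le_of_ne ((toeplitz_posSemidef hμ d).dotProduct_mulVec_nonneg v) fun h0 => ?_
  obtain ⟨⟨m₀, k₀⟩, hmk⟩ := Function.ne_iff.1 hv
  -- P carries v in column k₀ and zeros elsewhere, so the only possibly nonzero entry of ⟪P, P⟫ is
  -- v*Tv, at (k₀, k₀).
  let P : MatrixPoly s := ∑ m : Fin (d + 1),
    Polynomial.monomial m (Matrix.of fun k i => if i = k₀ then v (m, k) else 0)
  have hc : ∀ m : Fin (d + 1), P.coeff m = Matrix.of fun k i => if i = k₀ then v (m, k) else 0 := by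
    intro m
    simp only [P, Polynomial.finsetSum_coeff, Polynomial.coeff_monomial]
    rw [Finset.sum_eq_single m] <;> simp +contextual [Fin.val_inj]
  have hdeg : P.natDegree ≤ d :=
    Polynomial.natDegree_sum_le_of_forall_le _ _ fun m _ =>
      (Polynomial.natDegree_monomial_le _).trans (by omega)
  have hP0 : P ≠ 0 := by
    intro h
    have := congrFun (congrFun (hc m₀) k₀) k₀
    simp [h] at this
    exact hmk this.symm
  refine hnd P hdeg hP0 ?_
  rw [innerProd_eq μ hdeg hdeg]
  have hA : coeffMatrix d P = Matrix.of fun a i => if i = k₀ then v a else 0 := by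
    ext a i
    simp [coeffMatrix, hc]
  ext i j
  rw [hA, Matrix.mul_assoc, Matrix.mul_apply]
  by_cases hi : i = k₀ <;> by_cases hj : j = k₀
  · simpa [hi, hj, Matrix.mul_apply, dotProduct, mulVec] using h0.symm
  all_goals simp [hi, hj, Matrix.mul_apply]

end MatrixMeasure
end OMPUC

namespace OMPUC

open Filter Topology Matrix

namespace MatrixMeasure

variable {s : ℕ}

/-! ### Measures with constant matrix density; Haar measure. -/

/-- The matrix measure `W • m` with a constant matrix density. -/
noncomputable def ofMeasure (m : Measure UnitCircle) [IsFiniteMeasure m]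
    (W : Matrix (Fin s) (Fin s) ℂ) : MatrixMeasure s :=
  m.toSignedMeasure.mapRange
    (LinearMap.toSpanSingleton ℝ (Matrix (Fin s) (Fin s) ℂ) W).toAddMonoidHom
    (continuous_id.smul continuous_const)

theorem ofMeasure_apply (m : Measure UnitCircle) [IsFiniteMeasure m]
    (W : Matrix (Fin s) (Fin s) ℂ) {Ω : Set UnitCircle} (hΩ : MeasurableSet Ω) :
    ofMeasure m W Ω = m.real Ω • W := by
  rw [← Measure.toSignedMeasure_apply_measurable hΩ]
  rfl

theorem ofMeasure_isPosSemidef (m : Measure UnitCircle) [IsFiniteMeasure m]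
    {W : Matrix (Fin s) (Fin s) ℂ} (hW : W.PosSemidef) : (ofMeasure m W).IsPosSemidef := by
  intro Ω hΩ
  rw [ofMeasure_apply m W hΩ]
  exact hW.smul measureReal_nonneg

theorem cintegral_ofMeasure (m : Measure UnitCircle) [IsFiniteMeasure m]
    (W : Matrix (Fin s) (Fin s) ℂ) (k l : Fin s) {f : UnitCircle → ℂ} (hf : Continuous f) :
    cintegral ((ofMeasure m W).entry k l) f = W k l * ∫ z, f z ∂m := by
  set ν := (ofMeasure m W).entry k l with hν
  have hval : ∀ S, MeasurableSet S → ν S = m.real S * W k l := fun S hS => by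
    rw [hν, entry_apply, ofMeasure_apply m W hS]
    simp
  -- Domination by a multiple of m lets the integral be computed over m, where induction on
  -- integrable functions reduces it to indicators.
  have hle : ν.variation ≤ ENNReal.ofReal ‖W k l‖ • m := by
    refine VectorMeasure.variation_le_of_forall_enorm_le fun S hS => ?_
    rw [hval S hS, Measure.smul_apply, smul_eq_mul, ← ofReal_norm, norm_mul, Complex.norm_real,
      Real.norm_of_nonneg measureReal_nonneg, ENNReal.ofReal_mul measureReal_nonneg, mul_comm,
      ofReal_measureReal]
  have hT : DominatedFinMeasAdditive m (ν.transpose (ContinuousLinearMap.mul ℝ ℂ)) ‖W k l‖ := by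
    refine ⟨fun S T hS hT _ _ hd =>
      (dominatedFinMeasAdditive_cbmApplyMeasure ν _).1 S T hS hT (measure_ne_top _ _)
        (measure_ne_top _ _) hd,
      fun S hS _ => ?_⟩
    refine (norm_cbmApplyMeasure_le ν (ContinuousLinearMap.mul ℝ ℂ) S).trans ?_
    rw [hval S hS, norm_mul, Complex.norm_real, Real.norm_of_nonneg measureReal_nonneg]
    simp [mul_comm]
  unfold cintegral
  rw [VectorMeasure.integral_eq_setToFun, ← setToFun_congr_measure_of_integrable _
    ENNReal.ofReal_ne_top hle hT _ f (integrable_of_continuous hf)]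
  refine (integrable_of_continuous (m := m) hf).induction
    (fun f : UnitCircle → ℂ => setToFun m _ hT f = W k l * ∫ z, f z ∂m) ?_ ?_ ?_ ?_
  · intro c S hS hm
    rw [setToFun_indicator_const hT hS hm.ne, integral_indicator hS, setIntegral_const]
    change c * ν S = _
    rw [hval S hS, Complex.real_smul]
    ring
  · intro f g _ hf hg h1 h2
    rw [setToFun_add hT hf hg, h1, h2, integral_add' hf hg, mul_add]
  · exact isClosed_eq (continuous_setToFun hT) (continuous_const.mul continuous_integral)
  · intro f g hfg _ h
    rw [← setToFun_congr_ae hT hfg, h, integral_congr_ae hfg]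

theorem toeplitz_ofMeasure (m : Measure UnitCircle) [IsFiniteMeasure m]
    (W : Matrix (Fin s) (Fin s) ℂ) (N : ℕ) (a b : Fin (N + 1) × Fin s) :
    (ofMeasure m W).toeplitz N a b =
      W a.2 b.2 * ∫ z : UnitCircle, star ((z : ℂ) ^ (a.1 : ℕ)) * (z : ℂ) ^ (b.1 : ℕ) ∂m :=
  cintegral_ofMeasure _ _ _ _ (continuous_monomial _ _)

theorem toeplitz_add (μ ν : MatrixMeasure s) (N : ℕ) :
    (μ + ν).toeplitz N = μ.toeplitz N + ν.toeplitz N := by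
  ext a b
  have h : (μ + ν).entry a.2 b.2 = μ.entry a.2 b.2 + ν.entry a.2 b.2 := rfl
  simp only [toeplitz, Matrix.of_apply, Matrix.add_apply, h]
  exact VectorMeasure.integral_add_vectorMeasure
    (integrable_of_continuous (continuous_monomial _ _))
    (integrable_of_continuous (continuous_monomial _ _))

theorem toeplitz_sum {ι : Type*} (S : Finset ι) (μ : ι → MatrixMeasure s) (N : ℕ) :
    (∑ n ∈ S, μ n).toeplitz N = ∑ n ∈ S, (μ n).toeplitz N := by
  classical
  induction S using Finset.induction_on with
  | empty =>
    ext a b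
    exact VectorMeasure.integral_zero_vectorMeasure
  | insert n S hn ih => rw [Finset.sum_insert hn, Finset.sum_insert hn, toeplitz_add, ih]

theorem isPosSemidef_add {μ ν : MatrixMeasure s} (hμ : μ.IsPosSemidef) (hν : ν.IsPosSemidef) :
    (μ + ν).IsPosSemidef := fun Ω hΩ => (hμ Ω hΩ).add (hν Ω hΩ)

theorem isPosSemidef_sum {ι : Type*} (S : Finset ι) {μ : ι → MatrixMeasure s}
    (hμ : ∀ n ∈ S, (μ n).IsPosSemidef) : (∑ n ∈ S, μ n).IsPosSemidef := by
  classical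
  induction S using Finset.induction_on with
  | empty => exact fun Ω _ => .zero
  | insert n S hn ih =>
    rw [Finset.sum_insert hn]
    exact isPosSemidef_add (hμ n (by simp)) (ih fun k hk => hμ k (by simp [hk]))

theorem infinite_unitCircle : (Metric.sphere (0 : ℂ) 1).Infinite := by
  refine Set.infinite_of_injOn_mapsTo (s := Set.Icc (0 : ℝ) 1)
    (f := fun t : ℝ => Complex.exp (t * Complex.I)) (fun x hx y hy h => ?_) (fun t _ => ?_)
    (Set.Icc_infinite zero_lt_one)
  · have h1 := congrArg Complex.re h
    simp only [Complex.exp_ofReal_mul_I_re] at h1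
    have hpi := Real.pi_gt_three
    exact Real.injOn_cos ⟨hx.1, by linarith [hx.2]⟩ ⟨hy.1, by linarith [hy.2]⟩ h1
  · simp [Complex.norm_exp_ofReal_mul_I]

/-- The form at v is ∫ ∑ |p_k|², with p_k the polynomial whose coefficients are v(·, k). If it
vanishes, continuity and the full support of Haar measure make each p_k zero on the whole circle, an
infinite set. -/
theorem toeplitz_haar_posDef (N : ℕ) :
    ((ofMeasure Measure.haar (1 : Matrix (Fin s) (Fin s) ℂ)).toeplitz N).PosDef := by
  set μ := ofMeasure Measure.haar (1 : Matrix (Fin s) (Fin s) ℂ) with hμ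
  have hpos : (μ.toeplitz N).PosSemidef :=
    toeplitz_posSemidef (ofMeasure_isPosSemidef _ Matrix.PosSemidef.one) N
  refine .of_dotProduct_mulVec_pos hpos.1 fun v hv => ?_
  refine lt_of_le_of_ne (hpos.dotProduct_mulVec_nonneg v) fun h0 => hv ?_
  let p : Fin s → ℂ[X] := fun k => ∑ m : Fin (N + 1), Polynomial.monomial m (v (m, k))
  have hpe : ∀ k (z : ℂ), (p k).eval z = ∑ m : Fin (N + 1), v (m, k) * z ^ (m : ℕ) := by
    intro k z
    simp [p, Polynomial.eval_finsetSum]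
  rw [quadratic_toeplitz] at h0
  simp_rw [← hpe] at h0
  have hc : ∀ k, Continuous fun z : UnitCircle => (p k).eval (z : ℂ) := fun k => by fun_prop
  have hint : (0 : ℂ) = ((∫ z : UnitCircle, ∑ k, ‖(p k).eval (z : ℂ)‖ ^ 2
      ∂Measure.haar : ℝ) : ℂ) := by
    refine h0.trans ?_
    rw [← integral_complex_ofReal]
    have hcc : ∀ k l, Continuous fun z : UnitCircle =>
        star ((p k).eval (z : ℂ)) * (p l).eval (z : ℂ) := fun k l => (hc k).star.mul (hc l)
    simp only [hμ, cintegral_ofMeasure _ _ _ _ (hcc _ _), Matrix.one_apply, ite_mul, one_mul,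
      zero_mul, Finset.sum_ite_eq, Finset.mem_univ,
      if_true]
    rw [← integral_finsetSum _ fun k _ => integrable_of_continuous (hcc k k)]
    refine integral_congr_ae (Eventually.of_forall fun z => ?_)
    simp [Complex.conj_mul']
  have hcs : Continuous fun z : UnitCircle => ∑ k, ‖(p k).eval (z : ℂ)‖ ^ 2 := by fun_prop
  have hz := (integral_eq_zero_iff_of_nonneg (μ := Measure.haar)
    (fun z : UnitCircle => Finset.sum_nonneg fun k _ => sq_nonneg ‖(p k).eval (z : ℂ)‖)
    (integrable_of_continuous hcs)).1 (by exact_mod_cast hint.symm)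
  have hz' := (hcs.ae_eq_iff_eq Measure.haar (continuous_const (y := (0 : ℝ)))).1 hz
  have hp : ∀ k, p k = 0 := fun k =>
    Polynomial.eq_zero_of_infinite_isRoot _ <| infinite_unitCircle.mono fun z hz => by
      have h1 := congrFun hz' ⟨z, hz⟩
      have h2 := (Finset.sum_eq_zero_iff_of_nonneg fun k _ =>
        sq_nonneg ‖(p k).eval z‖).1 h1 k (Finset.mem_univ k)
      simpa using h2
  ext ⟨m, k⟩
  have := congrArg (fun q => q.coeff m) (hp k)
  simpa [p, Polynomial.finsetSum_coeff, Polynomial.coeff_monomial, Fin.val_inj] using this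

end MatrixMeasure

/-! ### Perturbation of a positive definite matrix. -/

theorem exists_pos_posSemidef_sub_smul {n : Type*} [Fintype n] {T S : Matrix n n ℂ}
    (hT : T.PosDef) (hS : S.IsHermitian) : ∃ ε : ℝ, 0 < ε ∧ (T - ε • S).PosSemidef := by
  let q : Matrix n n ℂ → (n → ℂ) → ℝ := fun A v => (star v ⬝ᵥ (A *ᵥ v)).re
  have hq : ∀ A, Continuous (q A) := fun A => by
    simp only [q, dotProduct, mulVec, Pi.star_apply]
    fun_prop
  -- By compactness of the unit sphere, T ≥ c > 0 and |S| ≤ C there; ε = c / (|C| + 1) then works,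
  -- and scaling covers all v.
  obtain ⟨c, hc, hcT⟩ := (isCompact_sphere (0 : n → ℂ) 1).exists_forall_le' (hq T).continuousOn
    (a := 0) fun v hv => hT.re_dotProduct_pos (ne_zero_of_mem_unit_sphere (⟨v, hv⟩ :
      Metric.sphere (0 : n → ℂ) 1))
  obtain ⟨C, hC⟩ := (isCompact_sphere (0 : n → ℂ) 1).exists_bound_of_continuousOn
    (hq S).continuousOn
  have hC1 : 0 < |C| + 1 := by positivity
  have hH : (T - (c / (|C| + 1)) • S).IsHermitian :=
    hT.1.sub (hS.smul (IsSelfAdjoint.all (c / (|C| + 1))))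
  refine ⟨c / (|C| + 1), by positivity, .of_dotProduct_mulVec_nonneg hH fun v => ?_⟩
  rw [Complex.nonneg_iff]
  refine ⟨?_, (hH.im_star_dotProduct_mulVec_self v).symm⟩
  have hsub : ∀ u, q (T - (c / (|C| + 1)) • S) u = q T u - c / (|C| + 1) * q S u := by
    intro u
    simp only [q, sub_mulVec, smul_mulVec, dotProduct_sub, dotProduct_smul, Complex.sub_re,
      Complex.smul_re, smul_eq_mul]
  have hsphere : ∀ u, ‖u‖ = 1 → 0 ≤ q (T - (c / (|C| + 1)) • S) u := by
    intro u hu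
    have hu' : u ∈ Metric.sphere (0 : n → ℂ) 1 := by simpa using hu
    have h1 := hcT u hu'
    have h2 : q S u ≤ |C| + 1 :=
      (le_abs_self _).trans ((hC u hu').trans ((le_abs_self C).trans (by linarith)))
    have h3 : c / (|C| + 1) * q S u ≤ c / (|C| + 1) * (|C| + 1) := by gcongr
    rw [div_mul_cancel₀ _ hC1.ne'] at h3
    rw [hsub]
    linarith
  change 0 ≤ q _ v
  by_cases hv : v = 0
  · simp [q, hv]
  have hscale : q (T - (c / (|C| + 1)) • S) v =
      ‖v‖ ^ 2 * q (T - (c / (|C| + 1)) • S) (‖v‖⁻¹ • v) := by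
    have : ‖v‖ ≠ 0 := norm_ne_zero_iff.2 hv
    simp only [q, star_smul, mulVec_smul, dotProduct_smul, smul_dotProduct, star_trivial,
      Complex.smul_re, smul_eq_mul]
    field_simp
  rw [hscale]
  refine mul_nonneg (by positivity) (hsphere _ ?_)
  rw [norm_smul, norm_inv, norm_norm, inv_mul_cancel₀ (norm_ne_zero_iff.2 hv)]

end OMPUC

namespace OMPUC
open Matrix

/-! ### Spectral theorem for isometries; Gram vectors and atoms. -/

section

variable {E : Type*} [NormedAddCommGroup E] [InnerProductSpace ℂ E]

theorem norm_eq_one_of_isometry_eigenvalue {L : E →ₗᵢ[ℂ] E} {a : ℂ} {x : E} (hx : x ≠ 0)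
    (h : L x = a • x) : ‖a‖ = 1 := by
  have := L.norm_map x
  rw [h, norm_smul] at this
  exact mul_right_cancel₀ (norm_ne_zero_iff.2 hx) (by rw [this, one_mul])

/-- Isometry gives ā b ⟨x, y⟩ = ⟨x, y⟩, and since |a| = 1, ā b = 1 forces a = b. -/
theorem orthogonalFamily_eigenspaces_of_isometry (L : E →ₗᵢ[ℂ] E) :
    OrthogonalFamily ℂ (fun a => Module.End.eigenspace L.toLinearMap a)
      fun a => (Module.End.eigenspace L.toLinearMap a).subtypeₗᵢ := by
  rintro a b hab ⟨x, hx⟩ ⟨y, hy⟩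
  rw [Module.End.mem_eigenspace_iff] at hx hy
  change L x = a • x at hx
  change L y = b • y at hy
  change inner ℂ x y = 0
  by_contra hxy
  have hx0 : x ≠ 0 := by rintro rfl; simp at hxy
  have ha := norm_eq_one_of_isometry_eigenvalue hx0 hx
  have h1 := L.inner_map_map x y
  rw [hx, hy, inner_smul_left, inner_smul_right, ← mul_assoc] at h1
  have h2 : (starRingEnd ℂ) a * b = 1 := mul_right_cancel₀ hxy (by rw [h1, one_mul])
  have h3 : a * (starRingEnd ℂ) a = 1 := by rw [Complex.mul_conj']; simp [ha]
  apply hab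
  calc a = a * ((starRingEnd ℂ) a * b) := by rw [h2, mul_one]
    _ = b := by rw [← mul_assoc, h3, one_mul]

variable [FiniteDimensional ℂ E]

/-- The complement is L-invariant, so if nonzero it contains an eigenvector, which would be
orthogonal to itself. -/
theorem orthogonal_iSup_eigenspaces_of_isometry (L : E →ₗᵢ[ℂ] E) :
    (⨆ a, Module.End.eigenspace L.toLinearMap a)ᗮ = ⊥ := by
  set W := (⨆ a, Module.End.eigenspace L.toLinearMap a)ᗮ with hW
  have hmem : ∀ w, w ∈ W ↔ ∀ (a : ℂ) x, L x = a • x → inner ℂ x w = 0 := by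
    intro w
    rw [hW, ← Submodule.iInf_orthogonal, Submodule.mem_iInf]
    refine forall_congr' fun a => ?_
    rw [Submodule.mem_orthogonal]
    exact forall_congr' fun x => by rw [Module.End.mem_eigenspace_iff]; rfl
  have hinv : ∀ w ∈ W, L.toLinearMap w ∈ W := by
    intro w hw
    rw [hmem] at hw ⊢
    intro a x hx
    by_cases hx0 : x = 0
    · simp [hx0]
    have ha := norm_eq_one_of_isometry_eigenvalue hx0 hx
    have h1 := L.inner_map_map x w
    rw [hw a x hx, hx, inner_smul_left] at h1
    refine (mul_eq_zero.1 h1).resolve_left fun h => ?_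
    rw [map_eq_zero] at h
    simp [h] at ha
  by_contra hne
  have : Nontrivial W := Submodule.nontrivial_iff_ne_bot.2 hne
  obtain ⟨a, ha⟩ := Module.End.exists_eigenvalue (L.toLinearMap.restrict hinv)
  obtain ⟨x, hx⟩ := ha.exists_hasEigenvector
  have hx1 : L (x : E) = a • (x : E) := congrArg Subtype.val hx.apply_eq_smul
  have h0 := (hmem x).1 x.2 a x hx1
  exact hx.2 (Subtype.ext (inner_self_eq_zero.1 h0))

/-- A linear isometry of a finite-dimensional complex inner product space is diagonalizable in an
orthonormal basis, with unimodular eigenvalues. -/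
theorem exists_orthonormalBasis_of_isometry (L : E →ₗᵢ[ℂ] E) :
    ∃ (b : OrthonormalBasis (Fin (Module.finrank ℂ E)) ℂ E) (z : Fin (Module.finrank ℂ E) → ℂ),
      (∀ n, ‖z n‖ = 1) ∧ ∀ n, L (b n) = z n • b n := by
  classical
  have hV := orthogonalFamily_eigenspaces_of_isometry L
  have hV' : OrthogonalFamily ℂ
      (fun a : Module.End.Eigenvalues L.toLinearMap => Module.End.eigenspace L.toLinearMap a)
      fun a => (Module.End.eigenspace L.toLinearMap a).subtypeₗᵢ :=
    hV.comp Subtype.coe_injective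
  have hint : DirectSum.IsInternal
      fun a : Module.End.Eigenvalues L.toLinearMap => Module.End.eigenspace L.toLinearMap a := by
    rw [hV'.isInternal_iff]
    have : (⨆ a : Module.End.Eigenvalues L.toLinearMap, Module.End.eigenspace L.toLinearMap a) =
        ⨆ a, Module.End.eigenspace L.toLinearMap a := by
      refine le_antisymm (iSup_le fun a => le_iSup _ (a : ℂ)) (iSup_le fun a => ?_)
      by_cases ha : Module.End.HasEigenvalue L.toLinearMap a
      · exact le_iSup (fun a : Module.End.Eigenvalues L.toLinearMap =>
          Module.End.eigenspace L.toLinearMap a) ⟨a, ha⟩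
      · rw [Module.End.hasEigenvalue_iff, not_not] at ha
        rw [ha]
        exact bot_le
    rw [this, orthogonal_iSup_eigenspaces_of_isometry]
  let b := hint.subordinateOrthonormalBasis rfl hV'
  have hb : ∀ n, L (b n) = ((hint.subordinateOrthonormalBasisIndex rfl n hV' :
      Module.End.Eigenvalues L.toLinearMap) : ℂ) • b n :=
    fun n => Module.End.mem_eigenspace_iff.1
      (hint.subordinateOrthonormalBasis_subordinate rfl n hV')
  exact ⟨b, _, fun n => norm_eq_one_of_isometry_eigenvalue (b.orthonormal.ne_zero n) (hb n), hb⟩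

/-- Two families with the same Gram matrix are related by an isometry. -/
theorem exists_isometry_of_inner_eq {ι : Type*} [Fintype ι] (x y : ι → E)
    (h : ∀ i j, inner ℂ (x i) (x j) = inner ℂ (y i) (y j)) :
    ∃ L : E →ₗᵢ[ℂ] E, ∀ i, L (x i) = y i := by
  classical
  let X := Fintype.linearCombination ℂ x
  let Y := Fintype.linearCombination ℂ y
  have hXY : ∀ a, ‖Y a‖ = ‖X a‖ := by
    intro a
    have : inner ℂ (Y a) (Y a) = inner ℂ (X a) (X a) := by
      simp only [X, Y, Fintype.linearCombination_apply, sum_inner, inner_sum, inner_smul_left,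
        inner_smul_right, h]
    rw [inner_self_eq_norm_sq_to_K, inner_self_eq_norm_sq_to_K] at this
    have h2 : ‖Y a‖ ^ 2 = ‖X a‖ ^ 2 := by exact_mod_cast this
    exact (sq_eq_sq₀ (norm_nonneg _) (norm_nonneg _)).1 h2
  -- The choice of preimage g is harmless: ‖Y a‖ = ‖X a‖ shows that Y kills the kernel of X.
  obtain ⟨g, hg⟩ := X.rangeRestrict.exists_rightInverse_of_surjective X.range_rangeRestrict
  have hXg : ∀ w : LinearMap.range X, X (g w) = w := fun w =>
    congrArg Subtype.val (LinearMap.congr_fun hg w)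
  let L₀ : LinearMap.range X →ₗᵢ[ℂ] E := ⟨Y ∘ₗ g, fun w => by
    change ‖Y (g w)‖ = ‖(w : E)‖
    rw [hXY, hXg]⟩
  refine ⟨L₀.extend, fun i => ?_⟩
  have hx : ∀ i, X (Pi.single i 1) = x i := fun i => by
    simp [X, Fintype.linearCombination_apply_single]
  have hy : ∀ i, Y (Pi.single i 1) = y i := fun i => by
    simp [Y, Fintype.linearCombination_apply_single]
  have hmem : x i ∈ LinearMap.range X := ⟨_, hx i⟩
  rw [show x i = ((⟨x i, hmem⟩ : LinearMap.range X) : E) from rfl, L₀.extend_apply]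
  change Y (g ⟨x i, hmem⟩) = y i
  rw [← hy i, ← sub_eq_zero, ← map_sub, ← norm_eq_zero, hXY, norm_eq_zero, map_sub, hXg, hx,
    sub_self]

end

theorem exists_gram {n : Type*} [Fintype n] [DecidableEq n] {T : Matrix n n ℂ}
    (hT : T.PosSemidef) :
    ∃ x : n → EuclideanSpace ℂ n, ∀ i j, T i j = inner ℂ (x i) (x j) := by
  open scoped MatrixOrder Matrix.Norms.L2Operator in
  obtain ⟨B, hB⟩ := CStarAlgebra.nonneg_iff_eq_star_mul_self.1 hT.nonneg
  refine ⟨fun i => WithLp.toLp 2 fun k => B k i, fun i j => ?_⟩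
  rw [hB, EuclideanSpace.inner_eq_star_dotProduct, dotProduct_comm]
  rfl

/-- A positive semidefinite block Toeplitz matrix is the moment matrix of a finitely supported
matrix measure. -/
theorem exists_atoms_of_toeplitz {κ : Type*} [Fintype κ] [DecidableEq κ] {d : ℕ}
    {T : Matrix (Fin (d + 1) × κ) (Fin (d + 1) × κ) ℂ} (hT : T.PosSemidef)
    (hshift : ∀ (i j : Fin d) k l,
      T (i.succ, k) (j.succ, l) = T (i.castSucc, k) (j.castSucc, l)) :
    ∃ (r : ℕ) (z : Fin r → ℂ) (W : Fin r → Matrix κ κ ℂ), (∀ n, ‖z n‖ = 1) ∧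
      (∀ n, (W n).PosSemidef) ∧
      ∀ i k j l, T (i, k) (j, l) =
        ∑ n, W n k l * (star (z n ^ (i : ℕ)) * z n ^ (j : ℕ)) := by
  obtain ⟨x, hx⟩ := exists_gram hT
  -- The Toeplitz property says that blocks 0, …, d-1 and 1, …, d of the Gram vectors have equal
  -- Gram matrices, so the shift x(i, k) ↦ x(i+1, k) extends to an isometry of the whole space.
  obtain ⟨L, hL⟩ := exists_isometry_of_inner_eq
    (fun a : Fin d × κ => x (a.1.castSucc, a.2)) (fun a => x (a.1.succ, a.2))
    (fun a b => by rw [← hx, ← hx, hshift])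
  obtain ⟨b, z, hz, hb⟩ := exists_orthonormalBasis_of_isometry L
  have hbL : ∀ n w, inner ℂ (b n) (L w) = z n * inner ℂ (b n) w := by
    intro n w
    have h1 := L.inner_map_map (b n) w
    rw [hb, inner_smul_left] at h1
    rw [← h1, ← mul_assoc, Complex.mul_conj']
    simp [hz]
  have hcoef : ∀ n (i : Fin (d + 1)) k,
      inner ℂ (b n) (x (i, k)) = z n ^ (i : ℕ) * inner ℂ (b n) (x (0, k)) := by
    intro n i k
    induction i using Fin.induction with
    | zero => simp
    | succ i ih =>
      rw [← hL (i, k), hbL, ih, ← mul_assoc, Fin.val_succ, Fin.val_castSucc, pow_succ']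
  -- The weights are rank one, built from the coordinates of block 0 along b n; Parseval's identity
  -- gives the moments.
  refine ⟨_, z, fun n => vecMulVec (star fun k => inner ℂ (b n) (x (0, k)))
    (fun k => inner ℂ (b n) (x (0, k))), hz, fun n => posSemidef_vecMulVec_star_self _, ?_⟩
  intro i k j l
  rw [hx, ← b.sum_inner_mul_inner]
  refine Finset.sum_congr rfl fun n _ => ?_
  rw [← inner_conj_symm, hcoef n i, hcoef n j, map_mul]
  simp only [vecMulVec_apply, Pi.star_apply, starRingEnd_apply]
  ring

end OMPUC

namespace OMPUC

namespace MatrixMeasure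

open Matrix

variable {s : ℕ}

/-! ### Shift invariance, nondegeneracy from positive definite moment matrices, and conclusion. -/

theorem toeplitz_shift (μ : MatrixMeasure s) {d : ℕ} (i j : Fin d) (k l : Fin s) :
    μ.toeplitz d (i.succ, k) (j.succ, l) = μ.toeplitz d (i.castSucc, k) (j.castSucc, l) := by
  simp only [toeplitz, Matrix.of_apply, Fin.val_succ, Fin.val_castSucc]
  congr 1
  funext z
  have hz : star (z : ℂ) * z = 1 := by
    have h1 : ‖(z : ℂ)‖ = 1 := by simp
    rw [← starRingEnd_apply, Complex.conj_mul', h1]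
    simp
  calc star ((z : ℂ) ^ ((i : ℕ) + 1)) * (z : ℂ) ^ ((j : ℕ) + 1)
      = star ((z : ℂ) ^ (i : ℕ)) * (z : ℂ) ^ (j : ℕ) * (star (z : ℂ) * z) := by
        rw [pow_succ, pow_succ, star_mul]
        ring
    _ = _ := by rw [hz, mul_one]

/-- The last block of the column is the leading coefficient, here the identity. -/
theorem coeffMatrix_mulVec_injective_of_monic {P : MatrixPoly s} (hP : P.Monic) :
    Function.Injective (coeffMatrix P.natDegree P).mulVec := by
  intro v w h
  have h1 : ∀ u, (fun k => (coeffMatrix P.natDegree P *ᵥ u) (Fin.last _, k)) = u := by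
    intro u
    have : (fun k => (coeffMatrix P.natDegree P *ᵥ u) (Fin.last _, k)) =
      P.leadingCoeff *ᵥ u := rfl
    rw [this, hP.leadingCoeff, one_mulVec]
  rw [← h1 v, ← h1 w]
  exact congrArg (fun x : Fin (P.natDegree + 1) × Fin s → ℂ => fun k => x (Fin.last _, k)) h

theorem coeffMatrix_ne_zero {P : MatrixPoly s} (hP : P ≠ 0) :
    coeffMatrix P.natDegree P ≠ 0 := by
  intro h
  refine Polynomial.leadingCoeff_ne_zero.2 hP ?_
  ext k i
  exact congrFun (congrFun h (Fin.last _, k)) i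

theorem isNondegenerate_of_toeplitz_posDef {μ : MatrixMeasure s}
    (h : ∀ N, (μ.toeplitz N).PosDef) : μ.IsNondegenerate := by
  intro P hP
  rw [innerProd_eq μ le_rfl le_rfl]
  exact (h _).conjTranspose_mul_mul_same (coeffMatrix_mulVec_injective_of_monic hP)

theorem innerProd_self_ne_zero_of_toeplitz_posDef {μ : MatrixMeasure s}
    (h : ∀ N, (μ.toeplitz N).PosDef) {P : MatrixPoly s} (hP : P ≠ 0) :
    μ.innerProd P P ≠ 0 := by
  rw [innerProd_eq μ le_rfl le_rfl]
  intro h0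
  -- If a column A e_i were nonzero, its form e_i* (A*TA) e_i would be positive, yet A*TA = 0.
  refine coeffMatrix_ne_zero hP (Matrix.ext_of_mulVec_single fun i => ?_)
  rw [zero_mulVec]
  set u := Pi.single (M := fun _ : Fin s => ℂ) i 1
  by_contra hne
  have h1 := (h P.natDegree).dotProduct_mulVec_pos hne
  rw [star_mulVec, ← dotProduct_mulVec, mulVec_mulVec, mulVec_mulVec, h0,
    zero_mulVec, dotProduct_zero] at h1
  exact lt_irrefl _ h1

end MatrixMeasure

end OMPUC

open OMPUC OMPUC.MatrixMeasure

theorem mainTheorem9 {s d : ℕ} (hd : 0 < d) (μ : OMPUC.MatrixMeasure s)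
    (hμ : μ.IsPosSemidef) (hnd : μ.IsNondegenerateUpTo d) :
    ∃ μ' : OMPUC.MatrixMeasure s, μ'.IsPosSemidef ∧
      μ'.IsNondegenerate ∧
      (∀ P : OMPUC.MatrixPoly s, P ≠ 0 → μ'.innerProd P P ≠ 0) ∧
      ∀ P Q : OMPUC.MatrixPoly s, P.natDegree ≤ d → Q.natDegree ≤ d →
        μ.innerProd P Q = μ'.innerProd P Q := by

  set σ : OMPUC.MatrixMeasure s := ofMeasure Measure.haar 1
  obtain ⟨ε, hε, hεT⟩ := exists_pos_posSemidef_sub_smul (toeplitz_posDef hμ hnd)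
    (toeplitz_haar_posDef (s := s) d).1
  obtain ⟨r, z, W, hz, hW, hrep⟩ := exists_atoms_of_toeplitz hεT fun i j k l => by
    simp only [Matrix.sub_apply, Matrix.smul_apply, toeplitz_shift]
  let z' : Fin r → UnitCircle := fun n => ⟨z n, by simpa using hz n⟩
  let ν : OMPUC.MatrixMeasure s := ∑ n, ofMeasure (Measure.dirac (z' n)) (W n)
  let τ : OMPUC.MatrixMeasure s := ofMeasure Measure.haar (ε • 1)
  have hν : ν.IsPosSemidef := isPosSemidef_sum _ fun n _ => ofMeasure_isPosSemidef _ (hW n)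
  have hτ : τ.IsPosSemidef :=
    ofMeasure_isPosSemidef _ (Matrix.PosSemidef.one.smul hε.le)
  have hτT : ∀ N, τ.toeplitz N = ε • σ.toeplitz N := fun N => by
    ext a b
    rw [Matrix.smul_apply, toeplitz_ofMeasure, toeplitz_ofMeasure, Matrix.smul_apply,
      smul_mul_assoc]
  have hνT : ν.toeplitz d = μ.toeplitz d - ε • σ.toeplitz d := by
    ext ⟨i, k⟩ ⟨j, l⟩
    rw [hrep, toeplitz_sum, Matrix.sum_apply]
    refine Finset.sum_congr rfl fun n _ => ?_
    rw [toeplitz_ofMeasure, integral_dirac]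
  -- The moments of ν match the prescribed matrix only at size d, but at every size they are
  -- positive semidefinite, which is enough next to the Haar term.
  have hpos : ∀ N, ((ν + τ).toeplitz N).PosDef := fun N => by
    rw [toeplitz_add, hτT]
    exact Matrix.PosDef.posSemidef_add (toeplitz_posSemidef hν N)
      ((toeplitz_haar_posDef N).smul hε)
  refine ⟨ν + τ, isPosSemidef_add hν hτ, isNondegenerate_of_toeplitz_posDef hpos,
    fun P hP => innerProd_self_ne_zero_of_toeplitz_posDef hpos hP, fun P Q hP hQ => ?_⟩
  rw [innerProd_eq μ hP hQ, innerProd_eq (ν + τ) hP hQ, toeplitz_add, hνT, hτT, sub_add_cancel]
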